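/- Let $P$ be a poset, and write $p\prec q$ if $q$ covers $p$. An unrefinable $p$-chain of length $n$ is a sequence $c_0\prec c_1\prec\cdots\prec c_n=p$. Suppose that $P$ has a minimum $\hat 0$ and a maximum $\hat 1$, and that $P$ is filtered: for each $p\in P$ the maximum $d(p)\in\mathbb N$ of the lengths of the unrefinable $p$-chains exists, and $p<q$ implies $d(p)<d(q)$. Put $d(P)=\max_{p\in P} d(p)$. A coatom ordering $\ll$ of $P$ is a family $\{\ll_c\}_c$, where $c=(c_0\prec\cdots\prec c_n=\hat 1)$ ranges over all unrefinable $\hat 1$-chains and $\ll_c$ is a (strict) well-order on the set $P_{\prec c_0}=\{x\in P: x\prec c_0\}$. If $c$ has positive length, put $c'=(c_1\prec\cdots\prec c_n=\hat 1)$ and $$C(c)=\{x\prec c_0 : x<h \text{ for some } h\prec c_1 \text{ with } h\ll_{c'}c_0\};$$ put $C(\hat 1)=\emptyset$. The pair $(P,\ll)$ is dual CL-shellable if, for each unrefinable $\hat 1$-chain $c$: (CL0) every initial segment of $\ll_c$ (including all of $P_{\prec c_0}$) is finite or isomorphic to $(\mathbb N,\le)$; (CL1) $C(c)$ is an initial segment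 of $\ll_c$; (CL2) if $h'\ll_c h$ in $P_{\prec c_0}$ and $p\in P$ satisfies $p<h$ and $p<h'$, then there are $h''\in P_{\prec c_0}$ and $q\prec h$ with $h''\ll_c h$ and $p\le q<h''$. For $Q\subseteq P$ write $\langle Q\rangle=\{p\in P: p\le q\text{ for some }q\in Q\}$. Let $R$ be a commutative ring with unit. For a poset $S$ and a functor $G\colon S\to R\text{-mod}$, let $H_n(S;G)=(L_n\operatorname{colim}_S)(G)$ be the $n$-th left derived functor of $\operatorname{colim}_S\colon\mathrm{Fun}(S,R\text{-mod})\to R\text{-mod}$ evaluated at $G$. **Theorem.** Let $(P,\ll)$ be a dual CL-shellable pair, let $1\le i\le d(P)-1$, and let $F\colon P\to R\text{-mod}$ be a (covariant) functor. Suppose that $F$ is co-stable at degree $i$, that is, for every unrefinable $\hat 1$-chain $c$ of length $i$ the natural map $$\operatorname{colim}_{\langle C(c)\rangle}F\longrightarrow F(c_0)$$ is a monomorphism. Then $$H_i(P\setminus\{\hat 1\};F)=0.$$ -/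

import Mathlib

open CategoryTheory CategoryTheory.Limits

universe u v

/-! ### Chains, degrees, filtered posets -/

/-- `CoverChain t p` is the type of unrefinable `t`-chains `p = c₀ ⋖ c₁ ⋖ ⋯ ⋖ cₙ = t`, i.e. of
finite chains of consecutive covers with largest element `t` and least element `p`. -/
inductive CoverChain {P : Type u} [PartialOrder P] (t : P) : P → Type u
  /-- the chain of length `0` -/
  | top : CoverChain t t
  /-- put `p` below a chain starting at `q`, where `q` covers `p` -/
  | cons {p q : P} (h : p ⋖ q) (c : CoverChain t q) : CoverChain t p

namespace CoverChain

variable {P : Type u} [PartialOrder P]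

/-- The length `n` of the chain `c₀ ⋖ c₁ ⋖ ⋯ ⋖ cₙ`. -/
def length {t : P} : {p : P} → CoverChain t p → ℕ
  | _, top => 0
  | _, cons _ c => c.length + 1

end CoverChain

/-- The set of lengths of the unrefinable chains with largest element `p`. -/
def coverChainLengths {P : Type u} [PartialOrder P] (p : P) : Set ℕ :=
  {n | ∃ (s : P) (c : CoverChain p s), c.length = n}

/-- The degree `d(p)`: the maximum of the lengths of the unrefinable chains ending at `p`
(it is used for posets in which this maximum exists, see `FilteredPoset`). -/
noncomputable def elementDegree {P : Type u} [PartialOrder P] (p : P) : ℕ :=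
  sSup (coverChainLengths p)

/-- A poset is filtered if the degree of each element exists (the maximum is attained in `ℕ`) and
the degree map is strictly order preserving. -/
structure FilteredPoset (P : Type u) [PartialOrder P] : Prop where
  isGreatest_degree : ∀ p : P, IsGreatest (coverChainLengths p) (elementDegree p)
  strictMono_degree : StrictMono (elementDegree : P → ℕ)

/-- The degree `d(P) ∈ ℕ ∪ {∞}` of a filtered poset: the supremum of the degrees of its elements. -/
noncomputable def posetDegree (P : Type u) [PartialOrder P] : ℕ∞ :=
  ⨆ p : P, (elementDegree p : ℕ∞)

/-! ### Recursive coatom orderings -/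

/-- The set `P_{≺ p}` of elements covered by `p`. -/
abbrev LowerCovers {P : Type u} [PartialOrder P] (p : P) : Type u := {x : P // x ⋖ p}

/-- A coatom ordering: a (strict) well-order `rel c` on `P_{≺ c₀}` for each unrefinable chain
`c = (c₀ ⋖ ⋯ ⋖ ⊤)`. -/
structure CoatomOrdering (P : Type u) [PartialOrder P] [BoundedOrder P] where
  rel : {p : P} → CoverChain (⊤ : P) p → LowerCovers p → LowerCovers p → Prop
  isWellOrder : ∀ {p : P} (c : CoverChain (⊤ : P) p), IsWellOrder (LowerCovers p) (rel c)

namespace CoatomOrdering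

variable {P : Type u} [PartialOrder P] [BoundedOrder P]

/-- The set `C(c)`: it is empty for the chain of length `0`; for `c = (p ⋖ q ⋖ ⋯ ⋖ ⊤)` with
truncation `c' = (q ⋖ ⋯ ⋖ ⊤)`, it consists of the `x ⋖ p` such that `x < k` for some `k ⋖ q` which
strictly precedes `p` in the well-order of `c'`. -/
def C (L : CoatomOrdering P) : {p : P} → CoverChain (⊤ : P) p → Set (LowerCovers p)
  | _, .top => ∅
  | p, .cons (q := q) hpq c' =>
      {x | ∃ k : LowerCovers q, L.rel c' k ⟨p, hpq⟩ ∧ (x : P) < k}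

/-- The subset `⟨C(c)⟩` of `P`: all elements that are `≤` some element of `C(c)`. -/
def spanC (L : CoatomOrdering P) {p : P} (c : CoverChain (⊤ : P) p) : Set P :=
  {x | ∃ y ∈ L.C c, x ≤ (y : P)}

end CoatomOrdering

/-- `S` is an initial segment of the relation `r` (the whole type is allowed). -/
def IsInitialSegment {α : Type u} (r : α → α → Prop) (S : Set α) : Prop :=
  ∀ x ∈ S, ∀ y, r y x → y ∈ S

/-- The axioms of a recursive coatom ordering. -/
structure IsRecursiveCoatomOrdering {P : Type u} [PartialOrder P] [BoundedOrder P]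
    (L : CoatomOrdering P) : Prop where
  /-- Every initial segment is finite or isomorphic to `(ℕ, <)`. -/
  cl0 : ∀ {p : P} (c : CoverChain (⊤ : P) p) (S : Set (LowerCovers p)),
    IsInitialSegment (L.rel c) S →
      S.Finite ∨ Nonempty ((fun x y : S => L.rel c x y) ≃r ((· < ·) : ℕ → ℕ → Prop))
  /-- The set `C(c)` is an initial segment. -/
  cl1 : ∀ {p : P} (c : CoverChain (⊤ : P) p), IsInitialSegment (L.rel c) (L.C c)
  cl2 : ∀ {p : P} (c : CoverChain (⊤ : P) p) (h' h : LowerCovers p), L.rel c h' h →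
    ∀ x : P, x < h → x < h' →
      ∃ (h'' : LowerCovers p) (q : LowerCovers (h : P)),
        L.rel c h'' h ∧ x ≤ q ∧ (q : P) < h''

/-- `(P, ≪)` is a dual CL-shellable pair: `P` is a filtered poset with a maximum and a minimum, and
`≪` is a recursive coatom ordering of `P`. -/
structure IsDualCLShellable {P : Type u} [PartialOrder P] [BoundedOrder P]
    (L : CoatomOrdering P) : Prop where
  filtered : FilteredPoset P
  recursive : IsRecursiveCoatomOrdering L

/-! ### Functors on subposets, higher colimits, co-stability -/

section Functors

variable {P : Type u} [PartialOrder P] {R : Type v} [CommRing R]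

/-- The restriction of a functor on `P` to a subposet `S`. -/
def restrictTo (F : P ⥤ ModuleCat.{max u v} R) (S : Set P) : S ⥤ ModuleCat.{max u v} R where
  obj x := F.obj (x : P)
  map {x y} f := F.map (homOfLE (show (x : P) ≤ y from leOfHom f))
  map_id x := F.map_id (x : P)
  map_comp f g := by rw [← F.map_comp]; rfl

/-- If `p` is an upper bound of `S`, the maps `F x ⟶ F p`, `x ∈ S`, form a cocone. -/
def coconeOfUpperBound (F : P ⥤ ModuleCat.{max u v} R) (S : Set P) (p : P)
    (hp : p ∈ upperBounds S) : Cocone (restrictTo F S) where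
  pt := F.obj p
  ι :=
    { app := fun x => F.map (homOfLE (hp x.2))
      naturality := fun x y f => by
        dsimp only [restrictTo, Functor.const_obj_obj, Functor.const_obj_map]
        rw [← F.map_comp, Category.comp_id]
        rfl }

/-- The natural map `colim_S F ⟶ F p` for an upper bound `p` of `S`. -/
noncomputable def colimToUpperBound (F : P ⥤ ModuleCat.{max u v} R) (S : Set P) (p : P)
    (hp : p ∈ upperBounds S) : colimit (restrictTo F S) ⟶ F.obj p :=
  colimit.desc (restrictTo F S) (coconeOfUpperBound F S p hp)

/-- The category of functors from a poset to `R`-modules has enough projectives, so that left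
derived functors are defined on it. -/
instance enoughProjectives_functor_moduleCat :
    EnoughProjectives (P ⥤ ModuleCat.{max u v} R) where
  presentation F := by
    let X : P → (P ⥤ ModuleCat.{max u v} R) := fun p =>
      (evaluationLeftAdjoint (ModuleCat.{max u v} R) p).obj (Projective.over (F.obj p))
    let g : ∀ p, X p ⟶ F := fun p =>
      ((evaluationAdjunctionRight (ModuleCat.{max u v} R) p).homEquiv _ _).symm
        (Projective.π (F.obj p))
    have hX : ∀ p, Projective (X p) := fun p =>
      (evaluationAdjunctionRight (ModuleCat.{max u v} R) p).map_projective _ inferInstance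
    have hY : Projective (sigmaObj X) :=
      ⟨fun f e _ => ⟨Sigma.desc fun b => Projective.factorThru (Sigma.ι X b ≫ f) e,
        Sigma.hom_ext _ _ fun b => by
          rw [← Category.assoc, Sigma.ι_desc, Projective.factorThru_comp]⟩⟩
    refine ⟨{ p := sigmaObj X, projective := hY, f := Sigma.desc g, epi := ?_ }⟩
    have key : ∀ p, Epi ((Sigma.desc g).app p) := fun p => by
      have h1 : (Sigma.ι X p).app p ≫ (Sigma.desc g).app p = (g p).app p := by
        rw [← NatTrans.comp_app, Sigma.ι_desc]
      have h2 : (evaluationAdjunctionRight (ModuleCat.{max u v} R) p).unit.app _ ≫ (g p).app p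
          = Projective.π (F.obj p) := by
        have := ((evaluationAdjunctionRight (ModuleCat.{max u v} R) p).homEquiv _ _).apply_symm_apply
          (Projective.π (F.obj p))
        rw [Adjunction.homEquiv_unit] at this
        exact this
      have h3 : Epi ((g p).app p) := epi_of_epi_fac h2
      exact epi_of_epi_fac h1
    exact NatTrans.epi_of_epi_app _

instance colim_moduleCat_additive :
    (colim : (P ⥤ ModuleCat.{max u v} R) ⥤ ModuleCat.{max u v} R).Additive :=
  haveI : (Functor.const P : ModuleCat.{max u v} R ⥤ _).Additive := { }
  (colimConstAdj (J := P) (C := ModuleCat.{max u v} R)).left_adjoint_additive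

/-- The higher colimits (homology) `H_n(P; F) = (L_n colim)(F)`. -/
noncomputable def higherColim (n : ℕ) (F : P ⥤ ModuleCat.{max u v} R) : ModuleCat.{max u v} R :=
  (colim.leftDerived n).obj F

variable [BoundedOrder P]

theorem CoatomOrdering.mem_upperBounds_spanC (L : CoatomOrdering P) {p : P}
    (c : CoverChain (⊤ : P) p) : p ∈ upperBounds (L.spanC c) := by
  rintro x ⟨y, -, hxy⟩
  exact hxy.trans y.2.le

/-- Co-stability at degree `i`: for each unrefinable `⊤`-chain `c = (p ⋖ ⋯ ⋖ ⊤)` of length `i`, the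
natural map `colim_{⟨C(c)⟩} F ⟶ F p` is a monomorphism. -/
def CoStableAt (L : CoatomOrdering P) (F : P ⥤ ModuleCat.{max u v} R) (i : ℕ) : Prop :=
  ∀ (p : P) (c : CoverChain (⊤ : P) p), c.length = i →
    Mono (colimToUpperBound F (L.spanC c) p (L.mem_upperBounds_spanC c))

end Functors

/-!
Work over `U = P \ {⊤}`. Take a projective resolution `X` of the restriction of `F` to `U`, and let
`Zₘ` be its syzygies (the opcycles of `X`, with `Z₀ = F`), so that there are short exact sequences
`0 → Zₘ₊₁ → Xₘ → Zₘ → 0`. As `colim` is right exact, `H_{n+1}(U; F) = 0` as soon as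
`colim Zₙ₊₁ → colim Xₙ` is injective (`HomologicalComplex.exactAt_map_of_mono`).

The heart of the proof is a statement about one short exact sequence `0 → K → Q → F → 0` with `Q`
projective (`exists_cocone_mono_colimit_desc`). Let `x_a` be a well-ordered family of elements and
`D_a` the set of all `u ≤ x_a` that lie below an earlier `x_b`. If `colim_{D_a} F → F(x_a)` is
injective for all `a`, then `colim_S K → colim_S Q` is injective, where `S` is the downset generated
by the `x_a`. Indeed, an element of `colim_S K` is a finite sum of classes of `k_a ∈ K(x_a)`;
consider the largest index `a` that occurs. A projective functor is a summand of a sum of free ones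
(`exists_natural_decomposition`), so that an element of `Q(x_a)` which also comes from the earlier
`x_b` comes from `colim_{D_a} Q`. If the sum dies in `colim Q`, this applies to the image of `k_a`;
its preimage in `colim_{D_a} Q` maps to `0` in `F(x_a)`, hence to `0` in `colim_{D_a} F`, so it
comes from `colim_{D_a} K`. Thus `k_a` can be replaced by terms with smaller indices, and
well-founded induction applies.

For the lower covers of `p` in the order of a chain `c` ending at `p`, axiom (CL2) says that `D_a`
is `⟨C(a ⋖ c)⟩` (`IsRecursiveCoatomOrdering.mem_spanC_cons_iff`). Applied to the initial segment
`C(c)`, the statement shows that co-stability of `F` at degree `j + 1` gives co-stability of `K` at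
degree `j` (`CoStableBelowTop.syzygy`); applied to all coatoms of `P`, it shows that co-stability of
`F` at degree `1` makes `colim K → colim Q` injective (`CoStableBelowTop.mono_colim_map`). So
co-stability descends along the syzygies from degree `n + 1` for `F` to degree `1` for `Zₙ`, and the
theorem follows.
-/

/-! ### Projective functors on a poset -/

section ProjectiveFunctors

variable {U : Type u} [PartialOrder U] {R : Type v} [CommRing R]

/-- The finitely supported families `τ ∈ ⨁ₚ Q(p)` with `τ p = 0` unless `p ≤ x`. -/
def familiesBelow (Q : U ⥤ ModuleCat.{max u v} R) (x : U) :
    Submodule R (Π₀ p, Q.obj p) where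
  carrier := {τ | ∀ p, ¬ p ≤ x → τ p = 0}
  zero_mem' _ _ := rfl
  add_mem' ha hb p hp := by simp [ha p hp, hb p hp]
  smul_mem' c a ha p hp := by simp [ha p hp]

theorem familiesBelow_mono (Q : U ⥤ ModuleCat.{max u v} R) : Monotone (familiesBelow Q) :=
  fun _ _ hxy _ hτ p hp => hτ p fun h => hp (h.trans hxy)

open Classical in
/-- The map `⨁ₚ Q(p) → Q(x)`, `τ ↦ ∑_{p ≤ x} Q(p ≤ x)(τ p)`. -/
noncomputable def sumBelow (Q : U ⥤ ModuleCat.{max u v} R) (x : U) :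
    (Π₀ p, Q.obj p) →ₗ[R] Q.obj x :=
  DFinsupp.lsum ℕ fun p => if h : p ≤ x then (Q.map (homOfLE h)).hom else 0

theorem map_sumBelow (Q : U ⥤ ModuleCat.{max u v} R) {x y : U} (hxy : x ≤ y)
    {τ : Π₀ p, Q.obj p} (hτ : τ ∈ familiesBelow Q x) :
    (Q.map (homOfLE hxy)).hom (sumBelow Q x τ) = sumBelow Q y τ := by
  classical
  simp only [sumBelow, DFinsupp.lsum_apply_apply, DFinsupp.sumAddHom_apply, DFinsupp.sum, map_sum]
  refine Finset.sum_congr rfl fun p _ => ?_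
  by_cases hp : p ≤ x
  · simp only [hp, hp.trans hxy, dif_pos, LinearMap.toAddMonoidHom_coe]
    rw [← LinearMap.comp_apply, ← ModuleCat.hom_comp, ← Q.map_comp]
    rfl
  · simp [hτ p hp]

/-- The functor `x ↦ ⨁_{p ≤ x} Q(p)`. -/
noncomputable def familiesBelowFunctor (Q : U ⥤ ModuleCat.{max u v} R) :
    U ⥤ ModuleCat.{max u v} R where
  obj x := ModuleCat.of R (familiesBelow Q x)
  map f := ModuleCat.ofHom (Submodule.inclusion (familiesBelow_mono Q (leOfHom f)))
  map_id _ := rfl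
  map_comp _ _ := rfl

/-- The natural transformation `⨁_{p ≤ x} Q(p) → Q(x)`. -/
noncomputable def familiesBelowFunctorHom (Q : U ⥤ ModuleCat.{max u v} R) :
    familiesBelowFunctor Q ⟶ Q where
  app x := ModuleCat.ofHom ((sumBelow Q x).comp (familiesBelow Q x).subtype)
  naturality x y f := by
    ext τ
    exact (map_sumBelow Q (leOfHom f) τ.2).symm

instance epi_familiesBelowFunctorHom (Q : U ⥤ ModuleCat.{max u v} R) :
    Epi (familiesBelowFunctorHom Q) := by
  classical
  have (x : U) : Epi ((familiesBelowFunctorHom Q).app x) := by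
    rw [ModuleCat.epi_iff_surjective]
    intro q
    refine ⟨⟨DFinsupp.single x q, fun p hp => ?_⟩, ?_⟩
    · exact DFinsupp.single_eq_of_ne fun h => hp h.le
    · change sumBelow Q x (DFinsupp.single x q) = q
      rw [sumBelow, DFinsupp.lsum_single, dif_pos le_rfl]
      exact LinearMap.congr_fun (congrArg ModuleCat.Hom.hom (Q.map_id x)) q
  exact NatTrans.epi_of_epi_app _

/-- A projective functor `Q` on a poset is a direct summand of `x ↦ ⨁_{p ≤ x} Q(p)`: the
summation map onto `Q` has a section `σ`, whose compatibility with the structure maps says that the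
family `σ x q` is unchanged when `q` is moved up. -/
theorem exists_natural_decomposition (Q : U ⥤ ModuleCat.{max u v} R) [Projective Q] :
    ∃ σ : ∀ x, Q.obj x →ₗ[R] Π₀ p, Q.obj p,
      (∀ (x y : U) (h : x ≤ y) (q : Q.obj x), σ y ((Q.map (homOfLE h)).hom q) = σ x q) ∧
      (∀ x q, σ x q ∈ familiesBelow Q x) ∧
      ∀ x q, sumBelow Q x (σ x q) = q := by
  let s := Projective.factorThru (𝟙 Q) (familiesBelowFunctorHom Q)
  refine ⟨fun x => (familiesBelow Q x).subtype.comp (s.app x).hom, fun x y h q => ?_,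
    fun x q => ((s.app x).hom q).2, fun x q => ?_⟩
  · exact congrArg Subtype.val
      (LinearMap.congr_fun (congrArg ModuleCat.Hom.hom (s.naturality (homOfLE h))) q)
  · have h : s ≫ familiesBelowFunctorHom Q = 𝟙 Q := Projective.factorThru_comp _ _
    exact LinearMap.congr_fun (congrArg ModuleCat.Hom.hom (NatTrans.congr_app h x)) q

/-- `sumBelow Q x τ` lies in a submodule as soon as its summands do. -/
theorem sumBelow_mem {Q : U ⥤ ModuleCat.{max u v} R} {x : U} {τ : Π₀ p, Q.obj p}
    {N : Submodule R (Q.obj x)}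
    (hN : ∀ p (h : p ≤ x), τ p ≠ 0 → (Q.map (homOfLE h)).hom (τ p) ∈ N) :
    sumBelow Q x τ ∈ N := by
  classical
  refine dfinsuppSumAddHom_mem N τ _ fun p hp => ?_
  by_cases h : p ≤ x
  · simpa [h] using hN p h hp
  · simp [h]

end ProjectiveFunctors

/-! ### Colimits over subposets -/

section Colimits

variable {U : Type u} [PartialOrder U] {R : Type v} [CommRing R]

/-- A submodule of the colimit of `G` containing the images of all `G(x)` is everything. -/
theorem submodule_colimit_eq_top {G : U ⥤ ModuleCat.{max u v} R}
    {N : Submodule R (colimit G : ModuleCat.{max u v} R)}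
    (hN : ∀ x, LinearMap.range (colimit.ι G x).hom ≤ N) : N = ⊤ := by
  rw [← Submodule.ker_mkQ N, LinearMap.ker_eq_top]
  have : ModuleCat.ofHom N.mkQ = 0 := by
    refine colimit.hom_ext fun x => ?_
    ext y
    simpa using hN x ⟨y, rfl⟩
  exact congrArg ModuleCat.Hom.hom this

/-- The inclusion of a subposet as a functor. -/
def subsetInclusion (S : Set U) : S ⥤ U where
  obj x := x
  map f := homOfLE (leOfHom f)

/-- The transformation of restrictions to `S` induced by a natural transformation. -/
def restrictHom {G H : U ⥤ ModuleCat.{max u v} R} (f : G ⟶ H) (S : Set U) :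
    restrictTo G S ⟶ restrictTo H S where
  app x := f.app x
  naturality _ _ _ := f.naturality _

theorem ι_colimToUpperBound (G : U ⥤ ModuleCat.{max u v} R) (S : Set U) (p : U)
    (hp : p ∈ upperBounds S) (x : S) :
    colimit.ι (restrictTo G S) x ≫ colimToUpperBound G S p hp = G.map (homOfLE (hp x.2)) :=
  colimit.ι_desc (coconeOfUpperBound G S p hp) x

theorem colimMap_restrictHom_colimToUpperBound {G H : U ⥤ ModuleCat.{max u v} R} (f : G ⟶ H)
    (S : Set U) (p : U) (hp : p ∈ upperBounds S) :
    colimMap (restrictHom f S) ≫ colimToUpperBound H S p hp =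
      colimToUpperBound G S p hp ≫ f.app p := by
  refine colimit.hom_ext fun x => ?_
  rw [ι_colimMap_assoc, ι_colimToUpperBound, ← Category.assoc, ι_colimToUpperBound]
  exact (f.naturality _).symm

/-- The colimit over `S` is right exact. -/
theorem exists_colimMap_restrictHom_eq {K Q F : U ⥤ ModuleCat.{max u v} R} {f : K ⟶ Q} {g : Q ⟶ F}
    (w : f ≫ g = 0) (hex : (ShortComplex.mk f g w).Exact) (hg : Epi g) (S : Set U)
    (z : (colimit (restrictTo Q S) : ModuleCat.{max u v} R))
    (hz : (colimMap (restrictHom g S)).hom z = 0) :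
    ∃ y, (colimMap (restrictHom f S)).hom y = z := by
  let I := subsetInclusion S
  have hex' := hex.map_of_epi_of_preservesCokernel
    ((Functor.whiskeringLeft S U (ModuleCat.{max u v} R)).obj I ⋙ colim) hg inferInstance
  exact (ShortComplex.moduleCat_exact_iff _).1 hex' z hz

theorem map_mem_range_colimToUpperBound (G : U ⥤ ModuleCat.{max u v} R) (S : Set U) (p : U)
    (hp : p ∈ upperBounds S) {x : U} (hx : x ∈ S) (y : G.obj x) :
    (G.map (homOfLE (hp hx))).hom y ∈ LinearMap.range (colimToUpperBound G S p hp).hom :=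
  ⟨(colimit.ι (restrictTo G S) ⟨x, hx⟩).hom y, LinearMap.congr_fun
    (congrArg ModuleCat.Hom.hom (ι_colimToUpperBound G S p hp ⟨x, hx⟩)) y⟩

theorem ι_restrictTo_map (G : U ⥤ ModuleCat.{max u v} R) (S : Set U) {x y : U} (hx : x ∈ S)
    (hy : y ∈ S) (h : x ≤ y) (m : G.obj x) :
    (colimit.ι (restrictTo G S) ⟨y, hy⟩).hom ((G.map (homOfLE h)).hom m) =
      (colimit.ι (restrictTo G S) ⟨x, hx⟩).hom m :=
  LinearMap.congr_fun (congrArg ModuleCat.Hom.hom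
    (colimit.w (restrictTo G S) (homOfLE (show (⟨x, hx⟩ : S) ≤ ⟨y, hy⟩ from h)))) m

end Colimits

/-! ### Adding principal downsets one at a time -/

section Core

/-- A nonzero element of a span of submodules indexed by a well-order has a largest index. -/
theorem Submodule.exists_mem_sup_of_mem_iSup {A M ι : Type*} [Ring A] [AddCommGroup M] [Module A M]
    (r : ι → ι → Prop) [IsWellOrder ι r] (N : ι → Submodule A M) (p : ι → Prop) {z : M}
    (hz : z ∈ ⨆ b : {b // p b}, N b) :
    z = 0 ∨ ∃ b, p b ∧ z ∈ N b ⊔ ⨆ c : {c // r c b}, N c := by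
  have hmono (b b' : ι) (h : r b b') :
      N b ⊔ ⨆ c : {c // r c b}, N c ≤ N b' ⊔ ⨆ c : {c // r c b'}, N c :=
    le_sup_of_le_right (sup_le (le_iSup_of_le (⟨b, h⟩ : {c // r c b'}) le_rfl)
      (iSup_le fun c => le_iSup_of_le (⟨c, _root_.trans c.2 h⟩ : {c // r c b'}) le_rfl))
  induction hz using Submodule.iSup_induction' with
  | mem b y hy => exact .inr ⟨b, b.2, Submodule.mem_sup_left hy⟩
  | zero => exact .inl rfl
  | add y y' _ _ h h' =>
    rcases h with rfl | ⟨b, hb, h⟩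
    · simpa using h'
    rcases h' with rfl | ⟨b', hb', h'⟩
    · exact .inr ⟨b, hb, by simpa using h⟩
    rcases trichotomous_of r b b' with hbb | rfl | hbb
    · exact .inr ⟨b', hb', add_mem (hmono b b' hbb h) h'⟩
    · exact .inr ⟨b, hb, add_mem h h'⟩
    · exact .inr ⟨b, hb, add_mem h (hmono b' b hbb h')⟩

variable {U : Type u} [PartialOrder U] {R : Type v} [CommRing R]

/-- Let `0 → K → Q → F → 0` be exact with `Q` projective, let `(x a)` be a family indexed by a
well-order, and let `D a` consist of the elements below both `x a` and some earlier `x b`. If the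
maps `colim_{D a} F → F(x a)` are injective, then so is `colim_S K → colim_S Q → T`, where `S` is
the downset generated by the family and `Q → T` is a cocone which does not depend on the family
(it is the embedding of `Q` in `⨁ₚ Q(p)`). Since `T` receives `Q(p)` for all `p` and `colim Q`, this
gives both the injectivity of `colim_S K → K(p)` for an upper bound `p` and that of
`colim_S K → colim_S Q`. -/
theorem exists_cocone_mono_colimit_desc {K Q F : U ⥤ ModuleCat.{max u v} R} [Projective Q]
    (f : K ⟶ Q) (g : Q ⟶ F) (w : f ≫ g = 0) (hex : (ShortComplex.mk f g w).Exact)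
    (hf : Mono f) (hg : Epi g) :
    ∃ t : Cocone Q, ∀ {ι : Type u} (r : ι → ι → Prop) [IsWellOrder ι r] (x : ι → U)
      (S : Set U) (_ : ∀ u, u ∈ S ↔ ∃ a, u ≤ x a)
      (D : ι → Set U) (_ : ∀ a u, u ∈ D a ↔ u ≤ x a ∧ ∃ b, r b a ∧ u ≤ x b)
      (hx : ∀ a, x a ∈ upperBounds (D a))
      (_ : ∀ a, Mono (colimToUpperBound F (D a) (x a) (hx a))),
      Mono (colimit.desc (restrictTo K S)
        (((Cocone.precompose f).obj t).whisker (subsetInclusion S))) := by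
  obtain ⟨σ, hσ, hσ_supp, hσ_sum⟩ := exists_natural_decomposition Q
  let t : Cocone Q :=
    { pt := ModuleCat.of R (Π₀ p, Q.obj p)
      ι :=
        { app := fun x => ModuleCat.ofHom (σ x)
          naturality := fun x y h => by
            ext q
            exact hσ x y (leOfHom h) q } }
  refine ⟨t, fun {ι} r _ x S hS D hD hx hmono => ?_⟩
  have hfinj (y : U) : Function.Injective (f.app y).hom :=
    (ModuleCat.mono_iff_injective (f.app y)).1 inferInstance
  have hxS (a : ι) : x a ∈ S := (hS _).2 ⟨a, le_rfl⟩
  let T : (colimit (restrictTo K S) : ModuleCat.{max u v} R) →ₗ[R] Π₀ p, Q.obj p :=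
    (colimit.desc (restrictTo K S)
      (((Cocone.precompose f).obj t).whisker (subsetInclusion S))).hom
  have hTι (y : U) (hy : y ∈ S) (k : K.obj y) :
      T ((colimit.ι (restrictTo K S) ⟨y, hy⟩).hom k) = σ y ((f.app y).hom k) :=
    LinearMap.congr_fun (congrArg ModuleCat.Hom.hom (colimit.ι_desc
      (((Cocone.precompose f).obj t).whisker (subsetInclusion S)) ⟨y, hy⟩)) k
  let N (a : ι) : Submodule R (colimit (restrictTo K S) : ModuleCat.{max u v} R) :=
    LinearMap.range (colimit.ι (restrictTo K S) ⟨x a, hxS a⟩).hom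
  let Nlt (a : ι) := ⨆ b : {b // r b a}, N b
  -- the summand of largest index can be moved into the summands of smaller index
  have key (a : ι) (k : K.obj (x a)) (z : _) (hz : z ∈ Nlt a)
      (h0 : T ((colimit.ι (restrictTo K S) ⟨x a, hxS a⟩).hom k + z) = 0) :
      (colimit.ι (restrictTo K S) ⟨x a, hxS a⟩).hom k ∈ Nlt a := by
    set q := (f.app (x a)).hom k
    -- the decomposition of `q` is minus that of the image of `z`, so it is supported below
    -- earlier `x b` as well as below `x a`
    have hzsupp : ∀ p, T z p ≠ 0 → ∃ b, r b a ∧ p ≤ x b := by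
      intro p hp
      by_contra! hcon
      refine hp ?_
      let Z : Submodule R (Π₀ p, Q.obj p) := LinearMap.ker (DFinsupp.lapply (R := R) p)
      have : Nlt a ≤ Z.comap T := by
        refine iSup_le fun b => ?_
        rintro _ ⟨(m : K.obj (x b)), rfl⟩
        change T _ p = 0
        rw [hTι]
        exact hσ_supp _ _ p (hcon b b.2)
      exact this hz
    have hqsupp : ∀ p, σ (x a) q p ≠ 0 → p ∈ D a := by
      intro p hp
      refine (hD a p).2 ⟨by_contra fun h => hp (hσ_supp _ _ p h), hzsupp p fun h => hp ?_⟩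
      rw [map_add, hTι] at h0
      have := DFunLike.congr_fun h0 p
      change σ (x a) q p + T z p = 0 at this
      rwa [h, add_zero] at this
    obtain ⟨e, he⟩ : q ∈ LinearMap.range (colimToUpperBound Q (D a) (x a) (hx a)).hom := by
      rw [← hσ_sum (x a) q]
      exact sumBelow_mem fun p hpx hp =>
        map_mem_range_colimToUpperBound Q (D a) (x a) (hx a) (hqsupp p hp) _
    -- `e` maps to `g (f k) = 0` in `F(x a)`, so it already vanishes in `colim_{D a} F`
    have hge : (colimMap (restrictHom g (D a))).hom e = 0 := by
      refine (ModuleCat.mono_iff_injective _).1 (hmono a) ?_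
      have h1 := LinearMap.congr_fun (congrArg ModuleCat.Hom.hom
        (colimMap_restrictHom_colimToUpperBound g (D a) (x a) (hx a))) e
      have h2 := LinearMap.congr_fun (congrArg ModuleCat.Hom.hom (NatTrans.congr_app w (x a))) k
      refine h1.trans ?_
      change (g.app (x a)).hom ((colimToUpperBound Q (D a) (x a) (hx a)).hom e) = _
      rw [he, map_zero]
      exact h2
    obtain ⟨κ, hκ⟩ := exists_colimMap_restrictHom_eq w hex hg (D a) e hge
    have hκk : (colimToUpperBound K (D a) (x a) (hx a)).hom κ = k := by
      apply hfinj
      have h1 := LinearMap.congr_fun (congrArg ModuleCat.Hom.hom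
        (colimMap_restrictHom_colimToUpperBound f (D a) (x a) (hx a))) κ
      refine h1.symm.trans ?_
      change (colimToUpperBound Q (D a) (x a) (hx a)).hom ((colimMap (restrictHom f (D a))).hom κ)
        = _
      rw [hκ, he]
    -- every element of `D a` lies below an earlier `x b`
    have htop : (Nlt a).comap ((colimit.ι (restrictTo K S) ⟨x a, hxS a⟩).hom.comp
        (colimToUpperBound K (D a) (x a) (hx a)).hom) = ⊤ := by
      refine submodule_colimit_eq_top fun y => ?_
      rintro _ ⟨(m : K.obj y), rfl⟩
      obtain ⟨hya, b, hba, hyb⟩ := (hD a y).1 y.2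
      change (colimit.ι (restrictTo K S) ⟨x a, hxS a⟩).hom
        ((colimToUpperBound K (D a) (x a) (hx a)).hom ((colimit.ι (restrictTo K (D a)) y).hom m)) ∈
          Nlt a
      have h1 : (colimToUpperBound K (D a) (x a) (hx a)).hom
          ((colimit.ι (restrictTo K (D a)) y).hom m) = (K.map (homOfLE hya)).hom m :=
        LinearMap.congr_fun (congrArg ModuleCat.Hom.hom
          (ι_colimToUpperBound K (D a) (x a) (hx a) y)) m
      rw [h1, ι_restrictTo_map K S ((hS _).2 ⟨a, hya⟩), ← ι_restrictTo_map K S _ (hxS b) hyb]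
      exact Submodule.mem_iSup_of_mem (⟨b, hba⟩ : {b // r b a}) ⟨_, rfl⟩
    rw [← hκk]
    exact htop.ge (Submodule.mem_top (x := κ))
  have zero_of_mem (a : ι) : ∀ z ∈ N a ⊔ Nlt a, T z = 0 → z = 0 := by
    induction a using WellFounded.induction (IsWellFounded.wf (r := r)) with
    | _ a ih =>
    intro z hz h0
    obtain ⟨_, ⟨k, rfl⟩, z', hz', rfl⟩ := Submodule.mem_sup.1 hz
    rcases Submodule.exists_mem_sup_of_mem_iSup r N _ (add_mem (key a k z' hz' h0) hz') with
      h | ⟨b, hb, h⟩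
    · exact h
    · exact ih b hb _ h h0
  have htop : ⨆ b : {_b : ι // True}, N b = ⊤ := by
    refine submodule_colimit_eq_top fun y => ?_
    obtain ⟨a, ha⟩ := (hS y).1 y.2
    rintro _ ⟨(m : K.obj y), rfl⟩
    refine Submodule.mem_iSup_of_mem (⟨a, trivial⟩ : {_b : ι // True}) ?_
    rw [← ι_restrictTo_map K S y.2 (hxS a) ha m]
    exact ⟨_, rfl⟩
  rw [ModuleCat.mono_iff_injective, injective_iff_map_eq_zero]
  intro z h0
  rcases Submodule.exists_mem_sup_of_mem_iSup r N _ (htop.ge (Submodule.mem_top (x := z))) with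
    h | ⟨b, -, h⟩
  · exact h
  · exact zero_of_mem b z h h0

end Core

/-! ### Change of the ambient poset -/

section Restriction

variable {P : Type u} [PartialOrder P] {R : Type v} [CommRing R]

theorem mono_colimit_desc_whisker_iff {A B : Type u} [PartialOrder A] [PartialOrder B] (E : A ⥤ B)
    [E.IsEquivalence] (G : B ⥤ ModuleCat.{max u v} R) (t : Cocone G) :
    Mono (colimit.desc (E ⋙ G) (t.whisker E)) ↔ Mono (colimit.desc G t) := by
  rw [← colimit.pre_desc]
  refine ⟨fun h => ?_, fun h => mono_comp _ _⟩
  rw [← IsIso.inv_hom_id_assoc (colimit.pre G E) (colimit.desc G t)]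
  exact mono_comp _ _

/-- For `S ⊆ V ⊆ P`, the colimits over `S` regarded as a subset of `P` and as a subset of `V`
agree. -/
theorem mono_colimToUpperBound_restrictTo (F : P ⥤ ModuleCat.{max u v} R) (V S : Set P)
    (hSV : S ⊆ V) (p : V) (hp : (p : P) ∈ upperBounds S)
    (hp' : p ∈ upperBounds (Subtype.val ⁻¹' S : Set V))
    (hF : Mono (colimToUpperBound F S p hp)) :
    Mono (colimToUpperBound (restrictTo F V) (Subtype.val ⁻¹' S) p hp') := by
  let E : (Subtype.val ⁻¹' S : Set V) ⥤ S :=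
    { obj := fun x => ⟨x.1.1, x.2⟩
      map := fun f => homOfLE (leOfHom f) }
  have : E.Full := ⟨fun f => ⟨homOfLE (leOfHom f), rfl⟩⟩
  have : E.Faithful := ⟨fun _ => Subsingleton.elim _ _⟩
  have : E.EssSurj := ⟨fun x => ⟨⟨⟨x.1, hSV x.2⟩, x.2⟩, ⟨Iso.refl _⟩⟩⟩
  have : E.IsEquivalence := { }
  exact (mono_colimit_desc_whisker_iff E (restrictTo F S) (coconeOfUpperBound F S p hp)).2 hF

theorem mono_colimit_desc_of_eq_univ {U : Type u} [PartialOrder U] (G : U ⥤ ModuleCat.{max u v} R)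
    (t : Cocone G) (S : Set U) (hS : ∀ x, x ∈ S)
    (h : Mono (colimit.desc (restrictTo G S) (t.whisker (subsetInclusion S)))) :
    Mono (colimit.desc G t) := by
  have : (subsetInclusion S).Full := ⟨fun f => ⟨homOfLE (leOfHom f), rfl⟩⟩
  have : (subsetInclusion S).Faithful := ⟨fun _ => Subsingleton.elim _ _⟩
  have : (subsetInclusion S).EssSurj := ⟨fun x => ⟨⟨x, hS x⟩, ⟨Iso.refl _⟩⟩⟩
  have : (subsetInclusion S).IsEquivalence := { }
  exact (mono_colimit_desc_whisker_iff (subsetInclusion S) G t).1 h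

end Restriction

/-! ### Co-stability of syzygies -/

section CoStability

variable {P : Type u} [PartialOrder P] [BoundedOrder P] {R : Type v} [CommRing R]

theorem CoatomOrdering.mem_upperBounds_preimage_spanC (L : CoatomOrdering P)
    {p : {p : P | p ≠ ⊤}} (c : CoverChain (⊤ : P) (p : P)) :
    p ∈ upperBounds (Subtype.val ⁻¹' L.spanC c) :=
  fun x hx => L.mem_upperBounds_spanC c (show (x : P) ∈ L.spanC c from hx)

/-- The variant of co-stability for functors on `P \ {⊤}`; it concerns chains of positive
length only. -/
def CoStableBelowTop (L : CoatomOrdering P) (G : {p : P | p ≠ ⊤} ⥤ ModuleCat.{max u v} R)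
    (j : ℕ) : Prop :=
  ∀ (p : {p : P | p ≠ ⊤}) (c : CoverChain (⊤ : P) (p : P)), c.length = j →
    Mono (colimToUpperBound G (Subtype.val ⁻¹' L.spanC c) p
      (L.mem_upperBounds_preimage_spanC c))

theorem CoStableAt.coStableBelowTop {L : CoatomOrdering P} {F : P ⥤ ModuleCat.{max u v} R} {j : ℕ}
    (hF : CoStableAt L F j) : CoStableBelowTop L (restrictTo F {p : P | p ≠ ⊤}) j :=
  fun p c hc => mono_colimToUpperBound_restrictTo F _ _
    (fun _ hx => ne_top_of_le_ne_top p.2 (L.mem_upperBounds_spanC c hx)) p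
    (L.mem_upperBounds_spanC c) _ (hF p c hc)

theorem CoStableBelowTop.of_iso {L : CoatomOrdering P}
    {G H : {p : P | p ≠ ⊤} ⥤ ModuleCat.{max u v} R} (e : G ≅ H) {j : ℕ}
    (hG : CoStableBelowTop L G j) : CoStableBelowTop L H j := by
  intro p c hc
  have := hG p c hc
  have h := colimMap_restrictHom_colimToUpperBound e.inv (Subtype.val ⁻¹' L.spanC c) p
    (L.mem_upperBounds_preimage_spanC c)
  have hid : colimMap (restrictHom e.inv (Subtype.val ⁻¹' L.spanC c)) ≫
      colimMap (restrictHom e.hom (Subtype.val ⁻¹' L.spanC c)) = 𝟙 _ := by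
    refine colimit.hom_ext fun x => ?_
    rw [ι_colimMap_assoc, ι_colimMap, Category.comp_id, ← Category.assoc]
    have : (restrictHom e.inv (Subtype.val ⁻¹' L.spanC c)).app x ≫
        (restrictHom e.hom (Subtype.val ⁻¹' L.spanC c)).app x = 𝟙 _ := e.inv_hom_id_app x.1
    rw [this, Category.id_comp]
  have : Mono (colimMap (restrictHom e.inv (Subtype.val ⁻¹' L.spanC c))) :=
    mono_of_mono_fac hid
  exact mono_of_mono_fac h.symm

variable {L : CoatomOrdering P} {K Q F : {p : P | p ≠ ⊤} ⥤ ModuleCat.{max u v} R} [Projective Q]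
  {f : K ⟶ Q} {g : Q ⟶ F}

/-- For a lower cover `a` of `p`, the set `⟨C(a ⋖ c)⟩` is the intersection of the downset of `a`
with the union of the downsets of the earlier lower covers of `p`. -/
theorem IsRecursiveCoatomOrdering.mem_spanC_cons_iff (hL : IsRecursiveCoatomOrdering L) {p : P}
    (c : CoverChain (⊤ : P) p) (a : LowerCovers p) (u : P) :
    u ∈ L.spanC (.cons a.2 c) ↔ u ≤ a ∧ ∃ b, L.rel c b a ∧ u ≤ b := by
  constructor
  · rintro ⟨y, ⟨k, hk, hyk⟩, huy⟩
    exact ⟨huy.trans y.2.le, k, hk, huy.trans hyk.le⟩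
  · rintro ⟨hua, b, hba, hub⟩
    have := L.isWellOrder c
    have hne : a ≠ b := by
      rintro rfl
      exact irrefl_of (L.rel c) _ hba
    have hua' : u < a := by
      refine lt_of_le_of_ne hua ?_
      rintro rfl
      exact a.2.2 (lt_of_le_of_ne hub fun h => hne (Subtype.ext h)) b.2.1
    have hub' : u < b := by
      refine lt_of_le_of_ne hub ?_
      rintro rfl
      exact b.2.2 (lt_of_le_of_ne hua fun h => hne (Subtype.ext h.symm)) a.2.1
    obtain ⟨h, q, hha, huq, hqh⟩ := hL.cl2 c b a hba u hua' hub'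
    exact ⟨q, ⟨h, hha, hqh⟩, huq⟩

/-- `exists_cocone_mono_colimit_desc` for an initial segment `A` of the lower covers of `p`. -/
theorem CoStableBelowTop.exists_cocone_mono_desc (hL : IsRecursiveCoatomOrdering L)
    {w : f ≫ g = 0} (hex : (ShortComplex.mk f g w).Exact) (hf : Mono f) (hg : Epi g) {j : ℕ}
    (hF : CoStableBelowTop L F (j + 1)) :
    ∃ t : Cocone Q, ∀ {p : P} (c : CoverChain (⊤ : P) p) (_ : c.length = j)
      (A : Set (LowerCovers p)) (_ : IsInitialSegment (L.rel c) A)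
      (S : Set {p : P | p ≠ ⊤}) (_ : ∀ u, u ∈ S ↔ ∃ a ∈ A, (u : P) ≤ a),
      Mono (colimit.desc (restrictTo K S)
        (((Cocone.precompose f).obj t).whisker (subsetInclusion S))) := by
  obtain ⟨t, ht⟩ := exists_cocone_mono_colimit_desc f g w hex hf hg
  refine ⟨t, fun {p} c hc A hA S hS => ?_⟩
  have := L.isWellOrder c
  have : IsWellOrder A (Subtype.val ⁻¹'o L.rel c) :=
    (RelEmbedding.preimage (Function.Embedding.subtype _) (L.rel c)).isWellOrder
  let x (a : A) : {p : P | p ≠ ⊤} := ⟨a.1, (a.1.2.lt.trans_le le_top).ne⟩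
  refine ht (Subtype.val ⁻¹'o L.rel c) x S (fun u => ?_)
    (fun a => Subtype.val ⁻¹' L.spanC (.cons a.1.2 c)) (fun a u => ?_) _
    (fun a => hF (x a) (.cons a.1.2 c) (congrArg (· + 1) hc))
  · rw [hS]
    exact ⟨fun ⟨a, ha, h⟩ => ⟨⟨a, ha⟩, h⟩, fun ⟨a, h⟩ => ⟨a, a.2, h⟩⟩
  · refine (hL.mem_spanC_cons_iff c a.1 u).trans (and_congr Iff.rfl ?_)
    exact ⟨fun ⟨b, hb, h⟩ => ⟨⟨b, hA a a.2 b hb⟩, hb, h⟩, fun ⟨b, hb, h⟩ => ⟨b, hb, h⟩⟩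

/-- Passing from `F` to the kernel of an epimorphism from a projective functor lowers the degree of
co-stability by one. -/
theorem CoStableBelowTop.syzygy (hL : IsRecursiveCoatomOrdering L)
    {w : f ≫ g = 0} (hex : (ShortComplex.mk f g w).Exact) (hf : Mono f) (hg : Epi g) {j : ℕ}
    (hF : CoStableBelowTop L F (j + 1)) : CoStableBelowTop L K j := by
  obtain ⟨t, ht⟩ := hF.exists_cocone_mono_desc hL hex hf hg
  intro p c hc
  have := ht c hc (L.C c) (hL.cl1 c) (Subtype.val ⁻¹' L.spanC c) fun u => Iff.rfl
  have h : colimToUpperBound K (Subtype.val ⁻¹' L.spanC c) p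
        (L.mem_upperBounds_preimage_spanC c) ≫
      f.app p ≫ t.ι.app p = colimit.desc (restrictTo K _)
        (((Cocone.precompose f).obj t).whisker (subsetInclusion _)) := by
    refine colimit.hom_ext fun x => ?_
    have hxp : x.1 ≤ p := L.mem_upperBounds_preimage_spanC c x.2
    have hnat : K.map (homOfLE hxp) ≫ f.app p ≫ t.ι.app p = f.app x.1 ≫ t.ι.app x.1 := by
      rw [f.naturality_assoc, t.w]
    rw [← Category.assoc, ι_colimToUpperBound]
    exact hnat.trans (colimit.ι_desc
      (((Cocone.precompose f).obj t).whisker (subsetInclusion (Subtype.val ⁻¹' L.spanC c))) x).symm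
  exact mono_of_mono_fac h

/-- Degrees of elements other than `⊤` are bounded by that of `⊤`, so above each of them there is a
maximal one. -/
theorem FilteredPoset.exists_le_covBy_top (hP : FilteredPoset P) {u : P} (hu : u ≠ ⊤) :
    ∃ a : LowerCovers (⊤ : P), u ≤ a := by
  have hwf : WellFounded ((· > ·) : {p : P | u ≤ p ∧ p ≠ ⊤} → _ → Prop) := by
    refine Subrelation.wf (r := InvImage (· < ·)
      fun p : {p : P | u ≤ p ∧ p ≠ ⊤} => elementDegree (⊤ : P) - elementDegree (p : P))
      (fun {a b} h => ?_) (InvImage.wf _ wellFounded_lt)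
    have h1 := hP.strictMono_degree (show (b : P) < a from h)
    have h2 := hP.strictMono_degree (lt_top_iff_ne_top.2 a.2.2)
    exact show _ - _ < _ - _ by omega
  obtain ⟨a, -, ha⟩ := hwf.has_min Set.univ ⟨⟨u, le_rfl, hu⟩, trivial⟩
  refine ⟨⟨a, lt_top_iff_ne_top.2 a.2.2, fun b hab hb => ?_⟩, a.2.1⟩
  exact ha ⟨b, a.2.1.trans hab.le, hb.ne⟩ trivial hab

/-- The first higher colimit of a functor which is co-stable at degree `1` vanishes, expressed by a
projective presentation. -/
theorem CoStableBelowTop.mono_colim_map (hL : IsDualCLShellable L)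
    {w : f ≫ g = 0} (hex : (ShortComplex.mk f g w).Exact) (hf : Mono f) (hg : Epi g)
    (hF : CoStableBelowTop L F 1) : Mono (colim.map f) := by
  obtain ⟨t, ht⟩ := CoStableBelowTop.exists_cocone_mono_desc hL.recursive hex hf hg hF
  have := mono_colimit_desc_of_eq_univ K ((Cocone.precompose f).obj t) Set.univ (fun _ => trivial)
    (ht .top rfl Set.univ (fun _ _ _ _ => trivial) Set.univ fun u =>
      ⟨fun _ => (hL.filtered.exists_le_covBy_top u.2).imp fun _ h => ⟨trivial, h⟩,
        fun _ => trivial⟩)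
  have h : colim.map f ≫ colimit.desc Q t = colimit.desc K ((Cocone.precompose f).obj t) :=
    colimit.hom_ext fun x => by simp
  exact mono_of_mono_fac h

end CoStability

/-! ### Syzygies of a projective resolution -/

section Resolution

variable {C : Type*} [Category* C] [Abelian C]

theorem HomologicalComplex.exact_d_pOpcycles (X : ChainComplex C ℕ) (n : ℕ) :
    (ShortComplex.mk (X.d (n + 1) n) (X.pOpcycles n) (X.d_pOpcycles _ _)).Exact :=
  ShortComplex.exact_of_g_is_cokernel _ (X.opcyclesIsCokernel (n + 1) n (by simp))

theorem HomologicalComplex.fromOpcycles_pOpcycles (X : ChainComplex C ℕ) (n : ℕ) :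
    X.fromOpcycles (n + 1) n ≫ X.pOpcycles n = 0 := by
  simp [← cancel_epi (X.pOpcycles (n + 1))]

theorem HomologicalComplex.exact_fromOpcycles_pOpcycles (X : ChainComplex C ℕ) (n : ℕ) :
    (ShortComplex.mk (X.fromOpcycles (n + 1) n) (X.pOpcycles n)
      (fromOpcycles_pOpcycles X n)).Exact := by
  let φ : ShortComplex.mk (X.d (n + 1) n) (X.pOpcycles n) (X.d_pOpcycles _ _) ⟶
      ShortComplex.mk (X.fromOpcycles (n + 1) n) (X.pOpcycles n) (fromOpcycles_pOpcycles X n) :=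
    { τ₁ := X.pOpcycles (n + 1), τ₂ := 𝟙 _, τ₃ := 𝟙 _ }
  have : Epi φ.τ₁ := inferInstanceAs (Epi (X.pOpcycles (n + 1)))
  have : IsIso φ.τ₂ := inferInstanceAs (IsIso (𝟙 _))
  have : Mono φ.τ₃ := inferInstanceAs (Mono (𝟙 _))
  exact (ShortComplex.exact_iff_of_epi_of_isIso_of_mono φ).1 (exact_d_pOpcycles X n)

theorem HomologicalComplex.mono_fromOpcycles (X : ChainComplex C ℕ) (n : ℕ)
    (h : X.ExactAt (n + 1)) : Mono (X.fromOpcycles (n + 1) n) :=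
  Preadditive.mono_of_isZero_kernel' _ (X.homologyIsKernel (n + 1) n (by simp)) h.isZero_homology

/-- For a right exact functor `T`, exactness of `T X` can be tested on the map from the image of
the opcycles. -/
theorem HomologicalComplex.exactAt_map_of_mono {D : Type*} [Category* D] [Abelian D] (T : C ⥤ D)
    [T.Additive] [PreservesFiniteColimits T] (X : ChainComplex C ℕ) (n : ℕ)
    (h : Mono (T.map (X.fromOpcycles (n + 1) n))) :
    ((T.mapHomologicalComplex _).obj X).ExactAt (n + 1) := by
  rw [exactAt_iff' _ (n + 2) (n + 1) n (by simp) (by simp)]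
  let φ : (ShortComplex.mk (X.d (n + 1 + 1) (n + 1)) (X.pOpcycles (n + 1))
        (X.d_pOpcycles _ _)).map T ⟶
      ((T.mapHomologicalComplex _).obj X).sc' (n + 2) (n + 1) n :=
    { τ₁ := 𝟙 _, τ₂ := 𝟙 _, τ₃ := T.map (X.fromOpcycles (n + 1) n)
      comm₁₂ := (Category.id_comp _).trans (Category.comp_id _).symm
      comm₂₃ := by
        change 𝟙 _ ≫ T.map (X.d (n + 1) n) = T.map (X.pOpcycles (n + 1)) ≫ T.map _
        rw [← T.map_comp, p_fromOpcycles]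
        exact Category.id_comp _ }
  have : Epi φ.τ₁ := inferInstanceAs (Epi (𝟙 _))
  have : IsIso φ.τ₂ := inferInstanceAs (IsIso (𝟙 _))
  have : Mono φ.τ₃ := h
  exact (ShortComplex.exact_iff_of_epi_of_isIso_of_mono φ).1
    ((exact_d_pOpcycles X (n + 1)).map_of_epi_of_preservesCokernel T inferInstance inferInstance)

end Resolution

/-! ### Vanishing of higher colimits -/

theorem mainTheorem2 {P : Type u} [PartialOrder P] [BoundedOrder P] {R : Type v} [CommRing R]
    (L : CoatomOrdering P) (hL : IsDualCLShellable L)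
    (i : ℕ) (hi : 1 ≤ i) (hi' : (i : ℕ∞) + 1 ≤ posetDegree P)
    (F : P ⥤ ModuleCat.{max u v} R) (hF : CoStableAt L F i) :
    IsZero (higherColim i (restrictTo F {p : P | p ≠ ⊤})) := by
  obtain ⟨n, rfl⟩ : ∃ n, i = n + 1 := ⟨i - 1, by omega⟩
  let Pr := ProjectiveResolution.of (restrictTo F {p : P | p ≠ ⊤})
  let X := Pr.complex
  have hmono (m : ℕ) : Mono (X.fromOpcycles (m + 1) m) :=
    HomologicalComplex.mono_fromOpcycles X m (Pr.complex_exactAt_succ m)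
  have hZ (m : ℕ) : ∀ j, m + j = n → CoStableBelowTop L (X.opcycles m) (j + 1) := by
    induction m with
    | zero =>
      rintro j rfl
      rw [zero_add] at hF
      exact hF.coStableBelowTop.of_iso (Pr.isColimitCokernelCofork.coconePointUniqueUpToIso
        (X.opcyclesIsCokernel 1 0 (by simp)))
    | succ m ih =>
      intro j hj
      exact (ih (j + 1) (by omega)).syzygy hL.recursive
        (HomologicalComplex.exact_fromOpcycles_pOpcycles X m) (hmono m) inferInstance
  have hcolim : Mono (colim.map (X.fromOpcycles (n + 1) n)) :=
    (hZ n 0 rfl).mono_colim_map hL (HomologicalComplex.exact_fromOpcycles_pOpcycles X n) (hmono n)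
      inferInstance
  exact (HomologicalComplex.exactAt_map_of_mono colim X n hcolim).isZero_homology.of_iso
    (Pr.isoLeftDerivedObj colim (n + 1))
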